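/- **Theorem.** Let $\ell$ be an odd prime and $p$ a prime with $\ell \mid p-1$, and let $\zeta\in\mathbb{F}_p$ be a primitive $\ell$-th root of unity. In an extension field $\Omega$ of $\mathbb{F}_p(t)$ (for example an algebraic closure) let $t^{1/\ell}$, $(1-t)^{1/\ell}$ and $\epsilon_\ell(t)^{1/\ell}$ be any $\ell$-th roots of $t$, of $1-t$ and of $$\epsilon_\ell(t)=\prod_{i=1}^{\ell-1}\bigl(1-\zeta^i t^{1/\ell}\bigr)^i,$$ and put $\mathcal{R}^{(\ell)}=\mathbb{F}_p(t)\bigl(t^{1/\ell},(1-t)^{1/\ell},\epsilon_\ell(t)^{1/\ell}\bigr)\subseteq\Omega$. For an integer $N\ge 0$ write $\{N\}=N-\ell\lfloor N/\ell\rfloor$. For $0\le i,j<\ell$ put $$\alpha^0_{i,j}=t^{i/\ell}(1-t)^{j/\ell},\qquad \alpha^k_{i,j}=t^{i/\ell}\Bigl(\prod_{n=1}^{\ell-1}\bigl(1-\zeta^{n+j}t^{1/\ell}\bigr)^{\{kn\}}\Bigr)^{1/\ell}\quad(0<k<\ell),$$ where $t^{i/\ell}=(t^{1/\ell})^i$,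 $(1-t)^{j/\ell}=((1-t)^{1/\ell})^j$, and for each pair $(k,j)$ with $k>0$ the $\ell$-th root of the product is any one $\ell$-th root of it in $\Omega$ (the same for all $i$). Then: 1. The $\ell^3$ elements $\alpha^k_{i,j}$ ($0\le i,j,k<\ell$) lie in $\mathcal{R}^{(\ell)}$ and form an integral basis of $\mathcal{R}^{(\ell)}/\mathbb{F}_p(t)$, that is, a basis of the integral closure of $\mathbb{F}_p[t]$ in $\mathcal{R}^{(\ell)}$ as an $\mathbb{F}_p[t]$-module. 2. The discriminant of this family is $c\,(t(1-t))^{\ell^2(\ell-1)}$ for some $c\in\mathbb{F}_p^\times$. 3. It generates the discriminant of $\mathcal{R}^{(\ell)}/\mathbb{F}_p(t)$: the ideal of $\mathbb{F}_p[t]$ generated by the discriminants of all $\mathbb{F}_p(t)$-bases of $\mathcal{R}^{(\ell)}$ consisting of elements integral over $\mathbb{F}_p[t]$ is $\bigl((t(1-t))^{\ell^2(\ell-1)}\bigr)$. -/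

import Mathlib

open Polynomial

namespace HeisenbergExtension

/-- `ε_ℓ = ∏_{i=1}^{ℓ-1} (1 - z^i u)^i`, where `z` is the `ℓ`-th root of unity and `u = t^{1/ℓ}`. -/
def epsilon {Ω : Type*} [Field Ω] (ℓ : ℕ) (z u : Ω) : Ω :=
  ∏ i ∈ Finset.Icc 1 (ℓ - 1), (1 - z ^ i * u) ^ i

/-- `∏_{n=1}^{ℓ-1} (1 - z^{n+j} u)^{{kn}}`, where `{N}` is the remainder of `N` modulo `ℓ`. -/
def radicand {Ω : Type*} [Field Ω] (ℓ : ℕ) (z u : Ω) (k j : ℕ) : Ω :=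
  ∏ n ∈ Finset.Icc 1 (ℓ - 1), (1 - z ^ (n + j) * u) ^ ((k * n) % ℓ)

/-- The field `F(u, v, w)`; with `F = 𝔽_p(t)`, `u = t^{1/ℓ}`, `v = (1-t)^{1/ℓ}` and
`w = ε_ℓ^{1/ℓ}` it is the mod `ℓ` Heisenberg extension of `𝔽_p(t)`. -/
def adjoinRoots (F : Type*) [Field F] {Ω : Type*} [Field Ω] [Algebra F Ω] (u v w : Ω) :
    IntermediateField F Ω :=
  IntermediateField.adjoin F {u, v, w}

/-- `α^0_{i,j} = u^i v^j`, and `α^k_{i,j} = u^i a_{k,j}` for `k > 0`, where `a_{k,j}` is the chosen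
`ℓ`-th root of `radicand ℓ z u k j`. -/
def alpha {Ω : Type*} [Field Ω] (u v : Ω) (a : ℕ → ℕ → Ω) (k i j : ℕ) : Ω :=
  if k = 0 then u ^ i * v ^ j else u ^ i * a k j

/-- The discriminant ideal of `L/K` with respect to `A ⊆ K`: the ideal of `A` generated by the
discriminants of all `K`-bases of `L` that consist of elements integral over `A`. -/
def discriminantIdeal (A K L : Type*) [CommRing A] [Field K] [Field L] [Algebra A K] [Algebra A L]
    [Algebra K L] : Ideal A :=
  Ideal.span {d : A | ∃ b : Module.Basis (Fin (Module.finrank K L)) K L,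
    (∀ i, IsIntegral A (b i)) ∧ algebraMap A K d = Algebra.discr K b}

end HeisenbergExtension

/-!
Write `F = ℤ/p`, `K = F(X)`, `E = K(u)` and `R = E(v, w)`, where `u ^ ℓ = X`. The integral closure
of `F[X]` in `E` is `F[X][u]`, which is a polynomial ring in `u` over `F`, hence factorial, with basis
`1, u, …, u ^ (ℓ - 1)` over `F[X]`. In it `1 - X` is the product of the pairwise non-associated
primes `π m = 1 - ζ ^ m * u`, where `m` runs through `ℤ/ℓ`.

Over `E` the extension `R` is a Kummer extension: `v` and `w` are `ℓ`-th roots of monomials in the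
`π m`, with exponent vectors `m ↦ 1` and `m ↦ m`. The combinations of these modulo `ℓ` are the
`ℓ ^ 2` affine exponent vectors `m ↦ c * m + d`, and the radicands of the elements `α^k_{i,j}` are
exactly the monomials with these exponents, reduced to lie between `0` and `ℓ - 1`
(`radicand_eq_affineRadicand`, `exponentIndex_bijective`). Let `y h` be an `ℓ`-th root of the
monomial of index `h = (c, d)`.

* For `h ≠ h'` the quotient `y h / y h'` is not in `E`, by unique factorization, so its minimal
  polynomial is `T ^ ℓ - c` and its trace to `E` vanishes (`RadicalFamily.trace_div_eq_zero`).
  As the `y h` span `R` (`RadicalFamily.span_range_y`), they form a basis.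
* The component `f * y h` of an integral `x` is up to a unit `y h * Tr (x / y h)`, which equals
  `∑ σ x * (y h / σ (y h))` over the embeddings `σ`, and the second factor is a root of unity; so
  the component is integral (`isIntegral_mul_trace_div`). Then `f ^ ℓ` times an `ℓ`-th power free
  monomial is in `F[X][u]`, hence so is `f` (`RadicalFamily.repr_mem_range`). Therefore the
  `u ^ i * y h` form an integral basis.
* Under the relative trace form `y h` pairs nontrivially only with `y (-h)`, and `y h * y (-h)` is,
  up to a root of unity, the product of the `π m` with nonzero exponent. The trace matrix of the
  integral basis is therefore block diagonal up to a permutation of its columns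
  (`discr_smul_of_trace_eq_zero`). Each `π m` occurs for `ℓ * (ℓ - 1)` of the `h`, so the norm of
  the product of these elements is a constant times `(1 - X) ^ (ℓ ^ 2 * (ℓ - 1))`, while the
  discriminant `X ^ (ℓ - 1)` of `E / K` enters with exponent `ℓ ^ 2`.
* A change to another basis of integral elements multiplies the discriminant by the square of an
  element of `F[X]` (`discriminantIdeal_eq_span`).
-/

set_option linter.unusedSectionVars false

namespace HeisenbergExtension

/-! ### Monomials in the primes of a factorial ring -/

section UniqueFactorization

variable {B M : Type*} [CommRing B] [IsDomain B] [UniqueFactorizationMonoid B]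
  [Fintype M] {π : M → B}

lemma emultiplicity_prod_pow (hπ : ∀ m, Prime (π m))
    (hne : ∀ m n, Associated (π m) (π n) → m = n) (e : M → ℕ) (m : M) :
    emultiplicity (π m) (∏ n, π n ^ e n) = e m := by
  classical
  rw [Finset.emultiplicity_prod (hπ m), Finset.sum_eq_single m]
  · rw [emultiplicity_pow (hπ m),
      (FiniteMultiplicity.of_prime_left (hπ m) (hπ m).ne_zero).emultiplicity_self, mul_one]
  · intro n _ hn
    rw [emultiplicity_pow (hπ m), emultiplicity_eq_zero.2, mul_zero]
    intro hd
    exact hn (hne _ _ ((hπ m).associated_of_dvd (hπ n) hd)).symm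
  · simp

lemma eq_of_associated_prod_pow (hπ : ∀ m, Prime (π m))
    (hne : ∀ m n, Associated (π m) (π n) → m = n) {e e' : M → ℕ}
    (h : Associated (∏ n, π n ^ e n) (∏ n, π n ^ e' n)) : e = e' := by
  funext m
  have h1 := emultiplicity_prod_pow hπ hne e m
  rw [emultiplicity_eq_of_associated_right h, emultiplicity_prod_pow hπ hne e' m] at h1
  exact_mod_cast h1.symm

lemma isUnit_of_pow_dvd_prod_pow (hπ : ∀ m, Prime (π m))
    (hne : ∀ m n, Associated (π m) (π n) → m = n) {ℓ : ℕ} (hℓ : ℓ ≠ 0) {e : M → ℕ}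
    (he : ∀ m, e m < ℓ) {b : B} (hb : b ^ ℓ ∣ ∏ n, π n ^ e n) : IsUnit b := by
  by_contra hu
  have h0 : b ≠ 0 := by
    rintro rfl
    rw [zero_pow hℓ, zero_dvd_iff] at hb
    exact Finset.prod_ne_zero_iff.2 (fun m _ => pow_ne_zero _ (hπ m).ne_zero) hb
  obtain ⟨q, hq, hqb⟩ := WfDvdMonoid.exists_irreducible_factor hu h0
  have hq' := hq.prime
  obtain ⟨m, -, hm⟩ := (Prime.dvd_finsetProd_iff hq' _).1
    ((dvd_pow_self q hℓ).trans ((pow_dvd_pow_of_dvd hqb ℓ).trans hb))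
  have has : Associated q (π m) := hq'.associated_of_dvd (hπ m) (hq'.dvd_of_dvd_pow hm)
  have h1 : π m ^ ℓ ∣ ∏ n, π n ^ e n :=
    (pow_dvd_pow_of_dvd (has.symm.dvd.trans hqb) ℓ).trans hb
  have h2 := le_emultiplicity_of_pow_dvd h1
  rw [emultiplicity_prod_pow hπ hne e m] at h2
  exact absurd (he m) (not_lt.2 (by exact_mod_cast h2))

/-- If `s` is not divisible by the `ℓ`-th power of a non-unit, then a fraction `x` with
`x ^ ℓ * s` integral is itself integral: the `ℓ`-th power of a reduced denominator of `x`
would divide `s`. -/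
lemma mem_range_of_pow_mul {E : Type*} [Field E] [Algebra B E] [IsFractionRing B E] {ℓ : ℕ}
    {s : B} (hs : ∀ b : B, b ^ ℓ ∣ s → IsUnit b) {x : E} {c : B}
    (hx : x ^ ℓ * algebraMap B E s = algebraMap B E c) : x ∈ Set.range (algebraMap B E) := by
  obtain ⟨a, b, hab, rfl⟩ := IsFractionRing.exists_reduced_fraction B x
  have hb0 : algebraMap B E b ≠ 0 :=
    IsFractionRing.to_map_ne_zero_of_mem_nonZeroDivisors b.2
  have h1 : a ^ ℓ * s = c * (b : B) ^ ℓ := by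
    apply IsFractionRing.injective B E
    rw [IsFractionRing.mk'_eq_div, div_pow, div_mul_eq_mul_div, div_eq_iff (pow_ne_zero _ hb0)]
      at hx
    simpa using hx
  have h2 : (b : B) ^ ℓ ∣ s :=
    (hab.symm.pow (m := ℓ) (n := ℓ)).dvd_of_dvd_mul_left (Dvd.intro_left c h1.symm)
  obtain ⟨b', hb'⟩ := hs _ h2
  refine ⟨a * ↑b'⁻¹, ?_⟩
  rw [IsFractionRing.mk'_eq_div, eq_div_iff hb0, ← map_mul, mul_assoc, ← hb']
  simp

end UniqueFactorization

/-! ### Roots of elements of a field containing the roots of unity -/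

section Kummer

variable {E R : Type*} [Field E] [Field R] [Algebra E R] {ℓ : ℕ}

lemma exists_root_mul_of_pow_eq [NeZero ℓ] {z : E} (hz : IsPrimitiveRoot z ℓ) {x y : E}
    (h : x ^ ℓ = y ^ ℓ) : ∃ i, x = z ^ i * y := by
  by_cases hy : y = 0
  · subst hy
    rw [zero_pow (NeZero.ne ℓ)] at h
    exact ⟨0, by simpa using pow_eq_zero_iff (NeZero.ne ℓ) |>.1 h⟩
  · obtain ⟨i, -, hi⟩ := hz.eq_pow_of_pow_eq_one (ξ := x / y) (by
      rw [div_pow, h, div_self (pow_ne_zero _ hy)])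
    exact ⟨i, by rw [hi, div_mul_cancel₀ _ hy]⟩

lemma mem_range_of_pow_eq_pow [NeZero ℓ] {z : E} (hz : IsPrimitiveRoot z ℓ) {x : R} {d : E}
    (h : x ^ ℓ = algebraMap E R d ^ ℓ) : x ∈ Set.range (algebraMap E R) := by
  obtain ⟨i, hi⟩ :=
    exists_root_mul_of_pow_eq (hz.map_of_injective (algebraMap E R).injective) h
  exact ⟨z ^ i * d, by rw [hi]; simp⟩

lemma minpoly_eq_X_pow_sub_C (hℓ : ℓ.Prime) {z : E} (hz : IsPrimitiveRoot z ℓ) {x : R} {c : E}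
    (hc : x ^ ℓ = algebraMap E R c) (hx : x ∉ Set.range (algebraMap E R)) :
    minpoly E x = X ^ ℓ - C c := by
  have : NeZero ℓ := ⟨hℓ.ne_zero⟩
  have hirr : Irreducible (X ^ ℓ - C c) := X_pow_sub_C_irreducible_of_prime hℓ fun b hb =>
    hx (mem_range_of_pow_eq_pow hz (d := b) (by rw [hc, ← hb, map_pow]))
  exact (minpoly.eq_of_irreducible_of_monic hirr (by simp [hc])
    (monic_X_pow_sub_C c hℓ.ne_zero)).symm

/-- Over a field containing the `ℓ`-th roots of unity, an `ℓ`-th root that is not itself in the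
field has minimal polynomial `X ^ ℓ - c`, which has no term of degree `ℓ - 1`. -/
lemma trace_eq_zero_of_pow_mem [FiniteDimensional E R] (hℓ : ℓ.Prime) {z : E}
    (hz : IsPrimitiveRoot z ℓ) {x : R} (hc : x ^ ℓ ∈ Set.range (algebraMap E R))
    (hx : x ∉ Set.range (algebraMap E R)) : Algebra.trace E R x = 0 := by
  obtain ⟨c, hc⟩ := hc
  rw [trace_eq_finrank_mul_minpoly_nextCoeff, minpoly_eq_X_pow_sub_C hℓ hz hc.symm hx,
    nextCoeff_of_natDegree_pos (by rw [natDegree_X_pow_sub_C]; exact hℓ.pos),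
    natDegree_X_pow_sub_C, coeff_sub, coeff_X_pow, coeff_C]
  have := hℓ.two_le
  rw [if_neg (by omega), if_neg (by omega)]
  simp

/-- `y * Tr(x / y)` is the sum of the conjugates of `x`, each multiplied by the quotient of `y`
by its conjugate, which is an `ℓ`-th root of unity. -/
lemma isIntegral_mul_trace_div [FiniteDimensional E R] [Algebra.IsSeparable E R] [NeZero ℓ]
    {A : Type*} [CommRing A] [Algebra A E] [Algebra A R] [IsScalarTower A E R]
    {x y : R} (hx : IsIntegral A x) (hy : y ^ ℓ ∈ Set.range (algebraMap E R)) :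
    IsIntegral A (y * algebraMap E R (Algebra.trace E R (x / y))) := by
  by_cases hy0 : y = 0
  · subst hy0; rw [zero_mul]; exact isIntegral_zero
  obtain ⟨c, hc⟩ := hy
  let Ω := AlgebraicClosure R
  have hinj : Function.Injective (IsScalarTower.toAlgHom A R Ω) := (algebraMap R Ω).injective
  rw [← isIntegral_algHom_iff _ hinj]
  have h1 : IsScalarTower.toAlgHom A R Ω (y * algebraMap E R (Algebra.trace E R (x / y))) =
      ∑ σ : R →ₐ[E] Ω, σ x * (algebraMap R Ω y / σ y) := by
    rw [map_mul, IsScalarTower.coe_toAlgHom', ← IsScalarTower.algebraMap_apply E R Ω,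
      trace_eq_sum_embeddings Ω, Finset.mul_sum]
    refine Finset.sum_congr rfl fun σ _ => ?_
    rw [map_div₀]; ring
  rw [h1]
  refine IsIntegral.sum _ fun σ _ => IsIntegral.mul ?_ ?_
  · exact hx.map (σ.restrictScalars A)
  · refine IsIntegral.of_pow (n := ℓ) (NeZero.pos ℓ) ?_
    have h2 : σ y ^ ℓ = algebraMap R Ω y ^ ℓ := by
      rw [← map_pow, ← map_pow, ← hc, AlgHom.commutes, ← IsScalarTower.algebraMap_apply]
    have h3 : algebraMap R Ω y ^ ℓ ≠ 0 := by
      rw [← map_pow]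
      exact (_root_.map_ne_zero _).2 (pow_ne_zero _ hy0)
    rw [div_pow, h2, div_self h3]
    exact isIntegral_one

lemma isSeparable_of_pow_mem (hℓ : (ℓ : E) ≠ 0) {x : R}
    (hx : x ^ ℓ ∈ Set.range (algebraMap E R)) : IsSeparable E x := by
  obtain ⟨c, hc⟩ := hx
  by_cases hc0 : c = 0
  · have : x = 0 := by
      subst hc0
      rw [map_zero] at hc
      exact pow_eq_zero_iff (by rintro rfl; simp at hℓ) |>.1 hc.symm
    rw [this, ← map_zero (algebraMap E R)]
    exact isSeparable_algebraMap 0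
  · exact (separable_X_pow_sub_C c hℓ hc0).of_dvd (minpoly.dvd _ _ (by simp [hc]))

end Kummer

/-! ### Kummer extensions generated by roots of monomials -/

section RadicalFamily

/-- A finite group `H` of exponent vectors modulo `ℓ` on pairwise non-associated primes `π m` of
`B`, with a chosen `ℓ`-th root `y h` in `R` of the monomial `∏ π m ^ e` for each `h`, the
exponents being reduced to `0 ≤ e < ℓ`. -/
structure RadicalFamily (ℓ : ℕ) (B R M H : Type*) [CommRing B] [Field R] [Algebra B R] [Fintype M]
    [AddCommGroup H] where
  /-- the primes -/
  π : M → B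
  prime : ∀ m, Prime (π m)
  eq_of_associated : ∀ m n, Associated (π m) (π n) → m = n
  /-- the exponent vector of an element of the group -/
  e : H →+ (M → ZMod ℓ)
  e_injective : Function.Injective e
  /-- the chosen roots -/
  y : H → R
  y_pow : ∀ h, y h ^ ℓ = algebraMap B R (∏ m, π m ^ (e h m).val)

namespace RadicalFamily

variable {ℓ : ℕ} [NeZero ℓ] {B E R M H : Type*} [CommRing B] [IsDomain B]
  [UniqueFactorizationMonoid B] [Field E] [Field R] [Algebra B E] [IsFractionRing B E]
  [Algebra E R] [Algebra B R] [IsScalarTower B E R] [Fintype M] [AddCommGroup H]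
  (F : RadicalFamily ℓ B R M H)

/-- The monomial whose `ℓ`-th root is `F.y h`. -/
def rad (h : H) : B := ∏ m, F.π m ^ (F.e h m).val

lemma y_pow_eq (h : H) : F.y h ^ ℓ = algebraMap B R (F.rad h) := F.y_pow h

include E in
variable (E) in
lemma y_ne_zero (h : H) : F.y h ≠ 0 := by
  intro h0
  have h1 := F.y_pow h
  rw [h0, zero_pow (NeZero.ne ℓ), IsScalarTower.algebraMap_apply B E R, eq_comm,
    map_eq_zero_iff _ (algebraMap E R).injective,
    map_eq_zero_iff _ (IsFractionRing.injective B E)] at h1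
  exact Finset.prod_ne_zero_iff.2 (fun m _ => pow_ne_zero _ (F.prime m).ne_zero) h1

lemma isUnit_of_pow_dvd_rad {h : H} {b : B} (hb : b ^ ℓ ∣ F.rad h) : IsUnit b :=
  isUnit_of_pow_dvd_prod_pow F.prime F.eq_of_associated (NeZero.ne ℓ)
    (fun _ => ZMod.val_lt _) hb

include E in
variable (E) in
lemma y_pow_mem (h : H) : F.y h ^ ℓ ∈ Set.range (algebraMap E R) :=
  ⟨algebraMap B E (F.rad h), by rw [y_pow_eq, ← IsScalarTower.algebraMap_apply]⟩

/-- If `y h / y h'` lies in the base field, it is a unit of `B`, and the exponents of `h` and `h'`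
agree by unique factorization. -/
lemma eq_of_div_mem_range {h h' : H} (hm : F.y h / F.y h' ∈ Set.range (algebraMap E R)) :
    h = h' := by
  obtain ⟨f, hf⟩ := hm
  rw [eq_div_iff (F.y_ne_zero E h')] at hf
  have h1 : f ^ ℓ * algebraMap B E (F.rad h') = algebraMap B E (F.rad h) := by
    apply (algebraMap E R).injective
    rw [map_mul, map_pow, ← IsScalarTower.algebraMap_apply, ← IsScalarTower.algebraMap_apply,
      ← y_pow_eq, ← y_pow_eq, ← mul_pow, hf]
  obtain ⟨b, rfl⟩ := mem_range_of_pow_mul (fun _ => F.isUnit_of_pow_dvd_rad) h1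
  have h2 : b ^ ℓ * F.rad h' = F.rad h := by
    apply IsFractionRing.injective B E
    rw [map_mul, map_pow, h1]
  have hb : IsUnit b := F.isUnit_of_pow_dvd_rad (Dvd.intro _ h2)
  have h3 : Associated (F.rad h') (F.rad h) :=
    ⟨(hb.pow ℓ).unit, by rw [IsUnit.unit_spec, mul_comm, h2]⟩
  have h4 := eq_of_associated_prod_pow F.prime F.eq_of_associated h3
  apply F.e_injective
  funext m
  exact ZMod.val_injective ℓ (congrFun h4 m).symm

lemma trace_div_eq_zero [FiniteDimensional E R] (hℓ : ℓ.Prime) {z : E} (hz : IsPrimitiveRoot z ℓ)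
    {h h' : H} (hh : h ≠ h') : Algebra.trace E R (F.y h / F.y h') = 0 := by
  refine trace_eq_zero_of_pow_mem hℓ hz ?_ fun hm => hh (F.eq_of_div_mem_range hm)
  obtain ⟨a, ha⟩ := F.y_pow_mem E h
  obtain ⟨b, hb⟩ := F.y_pow_mem E h'
  exact ⟨a / b, by rw [div_pow, map_div₀, ha, hb]⟩

lemma exists_smul_y_of_pow_eq {z : E} (hz : IsPrimitiveRoot z ℓ) {x : R} {h : H} {d : B}
    (hx : x ^ ℓ = algebraMap B R (d ^ ℓ * F.rad h)) :
    ∃ i, x = (z ^ i * algebraMap B E d) • F.y h := by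
  obtain ⟨i, hi⟩ := exists_root_mul_of_pow_eq (x := x) (y := algebraMap B R d * F.y h)
    (hz.map_of_injective (algebraMap E R).injective)
    (by rw [hx, mul_pow, y_pow_eq, map_mul, map_pow])
  exact ⟨i, by rw [hi, Algebra.smul_def, map_mul, map_pow,
    ← IsScalarTower.algebraMap_apply, mul_assoc]⟩

/-- Adding reduced exponents modulo `ℓ` costs a carry of `0` or `1` at each prime. -/
lemma rad_mul_rad (h h' : H) : F.rad h * F.rad h' =
    (∏ m, F.π m ^ (((F.e h m).val + (F.e h' m).val) / ℓ)) ^ ℓ * F.rad (h + h') := by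
  simp only [rad]
  rw [← Finset.prod_pow, ← Finset.prod_mul_distrib, ← Finset.prod_mul_distrib]
  refine Finset.prod_congr rfl fun m _ => ?_
  rw [map_add, Pi.add_apply, ZMod.val_add, ← pow_add, ← pow_mul, ← pow_add, Nat.div_add_mod']

lemma exists_y_mul_y {z : E} (hz : IsPrimitiveRoot z ℓ) (h h' : H) :
    ∃ f : E, F.y h * F.y h' = f • F.y (h + h') := by
  obtain ⟨i, hi⟩ := F.exists_smul_y_of_pow_eq hz (x := F.y h * F.y h') (h := h + h')
    (by rw [← rad_mul_rad, mul_pow, y_pow_eq, y_pow_eq, map_mul])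
  exact ⟨_, hi⟩

lemma rad_zero : F.rad 0 = 1 := by simp [rad]

/-- Opposite nonzero residues modulo `ℓ` add up to exactly `ℓ`. -/
lemma rad_mul_rad_neg [DecidableEq M] (h : H) :
    F.rad h * F.rad (-h) = (∏ m with F.e h m ≠ 0, F.π m) ^ ℓ := by
  rw [Finset.prod_filter, rad_mul_rad, add_neg_cancel, rad_zero, mul_one]
  congr 1
  refine Finset.prod_congr rfl fun m _ => ?_
  rw [map_neg, Pi.neg_apply, ZMod.neg_val]
  have := ZMod.val_lt (F.e h m)
  split_ifs with h0 h1
  · exact absurd h0 h1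
  · rw [h0]; simp
  · rw [Nat.add_sub_cancel' this.le, Nat.div_self (NeZero.pos ℓ), pow_one]

lemma exists_y_mul_y_neg [DecidableEq M] {z : E} (hz : IsPrimitiveRoot z ℓ) (h : H) :
    ∃ i, F.y h * F.y (-h) =
      algebraMap E R (z ^ i * algebraMap B E (∏ m with F.e h m ≠ 0, F.π m)) := by
  obtain ⟨i, hi⟩ := exists_root_mul_of_pow_eq
    (x := F.y h * F.y (-h)) (y := algebraMap B R (∏ m with F.e h m ≠ 0, F.π m))
    (hz.map_of_injective (algebraMap E R).injective)
    (by rw [mul_pow, y_pow_eq, y_pow_eq, ← map_mul, rad_mul_rad_neg, map_pow])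
  exact ⟨i, by rw [hi, map_mul, map_pow, ← IsScalarTower.algebraMap_apply]⟩

/-- The span of the roots `y h` is closed under multiplication, since `y h * y h'` is a scalar
multiple of `y (h + h')`. -/
lemma span_range_y {z : E} (hz : IsPrimitiveRoot z ℓ) {S : Set R} (hS : Algebra.adjoin E S = ⊤)
    (hy : ∀ s ∈ S, ∃ h, s ^ ℓ = algebraMap B R (F.rad h)) :
    Submodule.span E (Set.range F.y) = ⊤ := by
  set V := Submodule.span E (Set.range F.y)
  have hV : ∀ h, F.y h ∈ V := fun h => Submodule.subset_span ⟨h, rfl⟩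
  have hroot : ∀ x : R, (∃ h, x ^ ℓ = algebraMap B R (F.rad h)) → x ∈ V := by
    rintro x ⟨h, hx⟩
    obtain ⟨i, hi⟩ := F.exists_smul_y_of_pow_eq hz (x := x) (h := h) (d := 1)
      (by rw [hx, one_pow, one_mul])
    rw [hi]
    exact V.smul_mem _ (hV h)
  have hone : (1 : R) ∈ V := hroot 1 ⟨0, by simp [rad_zero]⟩
  have hmul : ∀ x y, x ∈ V → y ∈ V → x * y ∈ V := by
    intro x y hx hy
    refine Submodule.span_induction₂ (p := fun x y _ _ => x * y ∈ V) ?_ ?_ ?_ ?_ ?_ ?_ ?_ hx hy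
    · rintro _ _ ⟨h, rfl⟩ ⟨h', rfl⟩
      obtain ⟨f, hf⟩ := F.exists_y_mul_y hz h h'
      rw [hf]
      exact V.smul_mem _ (hV _)
    · intro y _; rw [zero_mul]; exact V.zero_mem
    · intro y _; rw [mul_zero]; exact V.zero_mem
    · intro _ _ _ _ _ _ h1 h2; rw [add_mul]; exact V.add_mem h1 h2
    · intro _ _ _ _ _ _ h1 h2; rw [mul_add]; exact V.add_mem h1 h2
    · intro _ _ _ _ _ h1; rw [smul_mul_assoc]; exact V.smul_mem _ h1
    · intro _ _ _ _ _ h1; rw [mul_smul_comm]; exact V.smul_mem _ h1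
  have hle : Algebra.adjoin E S ≤ V.toSubalgebra hone hmul :=
    Algebra.adjoin_le fun s hs => hroot s (hy s hs)
  rw [eq_top_iff]
  intro x _
  exact hle (by rw [hS]; trivial)

variable [FiniteDimensional E R] (hℓ : ℓ.Prime) {z : E} (hz : IsPrimitiveRoot z ℓ)

include F hℓ hz in
/-- The trace form of a separable extension is not zero, and `1` is up to a scalar the only
member of the spanning family `y` with non-zero trace. -/
lemma trace_one_ne_zero [Algebra.IsSeparable E R]
    (hspan : Submodule.span E (Set.range F.y) = ⊤) : Algebra.trace E R 1 ≠ 0 := by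
  intro h1
  apply Algebra.trace_ne_zero E R
  refine LinearMap.ext_on hspan ?_
  rintro _ ⟨h, rfl⟩
  rw [LinearMap.zero_apply]
  obtain ⟨i, hi⟩ := F.exists_smul_y_of_pow_eq hz (x := 1) (h := 0) (d := 1) (by simp [rad_zero])
  rw [map_one, mul_one] at hi
  have h2 : F.y h / F.y 0 = z ^ i • F.y h := by
    rw [div_eq_iff (F.y_ne_zero E 0), smul_mul_assoc, mul_comm, ← smul_mul_assoc, ← hi, one_mul]
  have h3 : Algebra.trace E R (F.y h / F.y 0) = 0 := by
    by_cases hh : h = 0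
    · rw [hh, div_self (F.y_ne_zero E _), h1]
    · exact F.trace_div_eq_zero hℓ hz hh
  rw [h2, map_smul, smul_eq_mul, mul_eq_zero] at h3
  exact h3.resolve_left (pow_ne_zero _ (hz.ne_zero (NeZero.ne ℓ)))

include hℓ hz in
lemma trace_sum_smul_div [Fintype H] (f : H → E) (h : H) :
    Algebra.trace E R ((∑ g, f g • F.y g) / F.y h) = f h * Algebra.trace E R 1 := by
  rw [Finset.sum_div, map_sum, Finset.sum_eq_single h]
  · rw [smul_div_assoc, div_self (F.y_ne_zero E h), map_smul, smul_eq_mul]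
  · intro g _ hg
    rw [smul_div_assoc, map_smul, F.trace_div_eq_zero hℓ hz hg, smul_zero]
  · simp

include hℓ hz in
lemma linearIndependent_y [Finite H] (h1 : Algebra.trace E R 1 ≠ 0) :
    LinearIndependent E F.y := by
  have := Fintype.ofFinite H
  rw [Fintype.linearIndependent_iff]
  intro f hf h
  have h2 := F.trace_sum_smul_div hℓ hz f h
  rw [hf, zero_div, map_zero, eq_comm, mul_eq_zero] at h2
  exact h2.resolve_right h1

include hℓ hz in
/-- The component of an integral element along `y h` is integral, and its coefficient is
integral because the monomial `rad h` is `ℓ`-th power free. -/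
lemma repr_mem_range [Fintype H] [Algebra.IsSeparable E R] (hunit : IsUnit (Fintype.card H : B))
    (b : Module.Basis H E R) (hb : ∀ h, b h = F.y h) {x : R} (hx : IsIntegral B x) (h : H) :
    b.repr x h ∈ Set.range (algebraMap B E) := by
  set n : B := (Fintype.card H : B)
  have htr : Algebra.trace E R 1 = algebraMap B E n := by
    rw [← map_one (algebraMap E R), Algebra.trace_algebraMap, Module.finrank_eq_card_basis b]
    simp [n]
  have hsum : ∑ g, b.repr x g • F.y g = x := by
    simp_rw [← hb]
    exact b.sum_repr x
  have h1 := isIntegral_mul_trace_div hx (F.y_pow_mem E h)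
  rw [← hsum, F.trace_sum_smul_div hℓ hz, htr] at h1
  set f := b.repr x h
  have h2 : IsIntegral B ((f * algebraMap B E n) ^ ℓ * algebraMap B E (F.rad h)) := by
    rw [← isIntegral_algebraMap_iff (algebraMap E R).injective]
    convert h1.pow ℓ using 1
    rw [mul_pow (F.y h), y_pow_eq, map_mul, map_pow, ← IsScalarTower.algebraMap_apply, mul_comm]
  obtain ⟨c, hc⟩ := IsIntegrallyClosed.isIntegral_iff.1 h2
  obtain ⟨d, hd⟩ := mem_range_of_pow_mul (fun _ => F.isUnit_of_pow_dvd_rad) hc.symm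
  obtain ⟨v, hv⟩ := hunit
  refine ⟨d * ↑v⁻¹, ?_⟩
  rw [map_mul, hd, mul_assoc, ← map_mul, ← hv, Units.mul_inv, map_one, mul_one]

end RadicalFamily

end RadicalFamily

/-! ### The discriminant of a tower -/

section Discriminant

variable {K E R ι H : Type*} [Field K] [Field E] [Field R] [Algebra K E] [Algebra E R]
  [Algebra K R] [IsScalarTower K E R] [Fintype ι] [DecidableEq ι] [Fintype H] [DecidableEq H]
  [FiniteDimensional K E] [FiniteDimensional E R]

/-- Multiplying one argument of the trace form by `d` multiplies the Gram matrix by the matrix of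
multiplication by `d`. -/
lemma det_trace_mul (b : Module.Basis ι K E) (d : E) :
    (Matrix.of fun i j => Algebra.trace K E (d * (b i * b j))).det =
      Algebra.norm K d * Algebra.discr K b := by
  have h : (Matrix.of fun i j => Algebra.trace K E (d * (b i * b j))) =
      (Algebra.leftMulMatrix b d).transpose * Algebra.traceMatrix K b := by
    ext i j
    have h1 : d * b i = ∑ k, Algebra.leftMulMatrix b d k i • b k := by
      conv_lhs => rw [← b.sum_repr (d * b i)]
      simp_rw [Algebra.leftMulMatrix_eq_repr_mul]
    rw [Matrix.of_apply, ← mul_assoc, h1, Finset.sum_mul, map_sum, Matrix.mul_apply]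
    refine Finset.sum_congr rfl fun k _ => ?_
    rw [smul_mul_assoc, map_smul, Matrix.transpose_apply, Algebra.traceMatrix_apply,
      Algebra.traceForm_apply, smul_eq_mul]
  rw [h, Matrix.det_mul, Matrix.det_transpose, Algebra.norm_eq_matrix_det b, Algebra.discr_def]

/-- If `y h` pairs to zero under the relative trace form with every `y h'` except `y (-h)`, then
after the permutation `h ↦ -h` of its columns the trace matrix of the products `b i * y h` is
block diagonal. -/
lemma discr_smul_of_trace_eq_zero [AddCommGroup H] (b : Module.Basis ι K E) (y : H → R)
    (hy : ∀ h h', h' ≠ -h → Algebra.trace E R (y h * y h') = 0) :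
    ∃ s : ℤˣ, Algebra.discr K (fun x : ι × H => b x.1 • y x.2) =
      ((s : ℤ) : K) * (Algebra.norm K (∏ h, Algebra.trace E R (y h * y (-h))) *
        Algebra.discr K b ^ Fintype.card H) := by
  let T : H → Matrix ι ι K := fun h =>
    Matrix.of fun i j => Algebra.trace K E (Algebra.trace E R (y h * y (-h)) * (b i * b j))
  let σ : Equiv.Perm (ι × H) := (Equiv.refl ι).prodCongr (Equiv.neg H)
  have hT : Algebra.traceMatrix K (fun x : ι × H => b x.1 • y x.2) =
      (Matrix.blockDiagonal T).submatrix id σ := by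
    ext ⟨i, h⟩ ⟨j, h'⟩
    rw [Algebra.traceMatrix_apply, Algebra.traceForm_apply, ← Algebra.trace_trace (S := E),
      smul_mul_smul_comm, map_smul, Matrix.submatrix_apply]
    simp only [id_eq, σ, Equiv.prodCongr_apply, Equiv.coe_refl, Prod.map, Equiv.neg_apply,
      Matrix.blockDiagonal_apply]
    split_ifs with hh
    · rw [hh]
      simp only [T, Matrix.of_apply, neg_neg, smul_eq_mul]
      congr 1
      ring
    · rw [hy h h' (fun h0 => hh (by rw [h0, neg_neg])), smul_zero, map_zero]
  refine ⟨Equiv.Perm.sign σ, ?_⟩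
  rw [Algebra.discr_def, hT, Matrix.det_permute', Matrix.det_blockDiagonal, map_prod,
    Finset.prod_congr rfl fun h _ => det_trace_mul b _, Finset.prod_mul_distrib,
    Finset.prod_const, Finset.card_univ]

end Discriminant

namespace RadicalFamily

variable {ℓ : ℕ} [NeZero ℓ] {B E R M H : Type*} [CommRing B] [IsDomain B]
  [UniqueFactorizationMonoid B] [Field E] [Field R] [Algebra B E] [IsFractionRing B E]
  [Algebra E R] [Algebra B R] [IsScalarTower B E R] [Fintype M] [AddCommGroup H]
  (F : RadicalFamily ℓ B R M H) [FiniteDimensional E R] {z : E} (hz : IsPrimitiveRoot z ℓ)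

include hz in
/-- `y h * y h'` is a scalar multiple of `y h / y (-h')`. -/
lemma trace_mul_eq_zero (hℓ : ℓ.Prime) {h h' : H} (hh : h' ≠ -h) :
    Algebra.trace E R (F.y h * F.y h') = 0 := by
  classical
  obtain ⟨i, hi⟩ := F.exists_y_mul_y_neg hz h'
  have h1 : F.y h * F.y h' = (z ^ i * algebraMap B E (∏ m with F.e h' m ≠ 0, F.π m)) •
      (F.y h / F.y (-h')) := by
    rw [Algebra.smul_def, ← hi]
    field_simp [F.y_ne_zero E (-h')]
  rw [h1, map_smul, F.trace_div_eq_zero hℓ hz (fun h0 => hh (by rw [h0, neg_neg])), smul_zero]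

include hz in
/-- `y h * y (-h)` is, up to a root of unity, the product of the primes whose exponent in `h` is
nonzero; here each prime is assumed to have nonzero exponent for exactly `N` of the `h`. -/
lemma exists_prod_trace [Fintype H] [DecidableEq M] {N : ℕ}
    (hN : ∀ m, Finset.card {h : H | F.e h m ≠ 0} = N) :
    ∃ i, ∏ h, Algebra.trace E R (F.y h * F.y (-h)) =
      (Module.finrank E R : E) ^ Fintype.card H * z ^ i * algebraMap B E (∏ m, F.π m) ^ N := by
  choose i hi using F.exists_y_mul_y_neg hz
  refine ⟨∑ h, i h, ?_⟩
  have h1 : ∀ h, Algebra.trace E R (F.y h * F.y (-h)) = (Module.finrank E R : E) *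
      (z ^ i h * algebraMap B E (∏ m with F.e h m ≠ 0, F.π m)) := fun h => by
    rw [hi, Algebra.trace_algebraMap, nsmul_eq_mul]
  rw [Finset.prod_congr rfl fun h _ => h1 h, Finset.prod_mul_distrib, Finset.prod_mul_distrib,
    Finset.prod_const, Finset.card_univ, Finset.prod_pow_eq_pow_sum, mul_assoc, ← map_prod,
    ← map_pow]
  congr 3
  simp_rw [Finset.prod_filter]
  rw [Finset.prod_comm, ← Finset.prod_pow]
  refine Finset.prod_congr rfl fun m _ => ?_
  rw [← Finset.prod_filter, Finset.prod_const, hN]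

end RadicalFamily

/-! ### The extension generated by a root of the variable -/

section RootOfX

variable {F K E : Type*} [Field F] [Field K] [Algebra F[X] K] [IsFractionRing F[X] K]
  [Field E] [Algebra K E] [Algebra F[X] E] [IsScalarTower F[X] K E] {ℓ : ℕ} {u : E}

lemma isIntegral_of_pow_eq_algebraMap {A R : Type*} [CommRing A] [CommRing R] [Algebra A R]
    (hℓ : ℓ ≠ 0) {x : R} {c : A} (h : x ^ ℓ = algebraMap A R c) : IsIntegral A x :=
  IsIntegral.of_pow (Nat.pos_of_ne_zero hℓ) (h ▸ isIntegral_algebraMap)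

lemma natCast_ne_zero_of_isPrimitiveRoot [NeZero ℓ] {A R : Type*} [CommRing A] [IsDomain A]
    [CommRing R] [IsDomain R] [Algebra A R] (hA : Function.Injective (algebraMap A R)) {z : A}
    (hz : IsPrimitiveRoot z ℓ) : (ℓ : R) ≠ 0 :=
  (hz.map_of_injective hA).neZero'.out

lemma isPrimitiveRoot_C {ζ : F} (hζ : IsPrimitiveRoot ζ ℓ) :
    IsPrimitiveRoot (C ζ) ℓ := hζ.map_of_injective C_injective

variable (hℓ : ℓ.Prime) {ζ : F} (hζ : IsPrimitiveRoot ζ ℓ) (hu : u ^ ℓ = algebraMap F[X] E X)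

include hℓ hζ hu

/-- `X` is not an `ℓ`-th power in `K`, for degree reasons. -/
lemma minpoly_root_X : minpoly K u = X ^ ℓ - C (algebraMap F[X] K X) := by
  have : NeZero ℓ := ⟨hℓ.ne_zero⟩
  refine minpoly_eq_X_pow_sub_C hℓ ((isPrimitiveRoot_C hζ).map_of_injective
    (IsFractionRing.injective F[X] K)) (by rw [hu, ← IsScalarTower.algebraMap_apply]) ?_
  rintro ⟨k, rfl⟩
  rw [IsScalarTower.algebraMap_apply F[X] K E, ← map_pow] at hu
  have hk := (algebraMap K E).injective hu
  obtain ⟨g, rfl⟩ := IsIntegrallyClosed.isIntegral_iff.1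
    (isIntegral_of_pow_eq_algebraMap hℓ.ne_zero hk)
  rw [← map_pow] at hk
  have h1 := congrArg natDegree (IsFractionRing.injective F[X] K hk)
  rw [natDegree_pow, natDegree_X] at h1
  exact hℓ.one_lt.ne' (Nat.eq_one_of_mul_eq_one_right h1)

variable (hgen : Algebra.adjoin K {u} = ⊤)

include hgen in
lemma exists_powerBasis_root_X : ∃ pb : PowerBasis K E, pb.gen = u ∧ pb.dim = ℓ := by
  have hint : IsIntegral K u := isIntegral_of_pow_eq_algebraMap hℓ.ne_zero
    (by rw [hu, IsScalarTower.algebraMap_apply F[X] K E])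
  have hg : (PowerBasis.ofAdjoinEqTop hint hgen).gen = u := by simp
  refine ⟨PowerBasis.ofAdjoinEqTop hint hgen, hg, ?_⟩
  rw [← PowerBasis.natDegree_minpoly, hg, minpoly_root_X (K := K) hℓ hζ hu,
    natDegree_X_pow_sub_C]

include hgen in
lemma exists_basis_root_X : ∃ b : Module.Basis (Fin ℓ) K E, ∀ i, b i = u ^ (i : ℕ) := by
  obtain ⟨pb, h1, h2⟩ := exists_powerBasis_root_X (K := K) hℓ hζ hu hgen
  exact ⟨pb.basis.reindex (finCongr h2), fun i => by simp [h1]⟩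

include hgen in
lemma finite_root_X : FiniteDimensional K E := by
  obtain ⟨b, -⟩ := exists_basis_root_X (K := K) hℓ hζ hu hgen
  exact Module.Finite.of_basis b

include hgen in
lemma norm_root_X : ∃ c : F, c ≠ 0 ∧ Algebra.norm K u = algebraMap F[X] K (C c * X) := by
  obtain ⟨pb, h1, h2⟩ := exists_powerBasis_root_X (K := K) hℓ hζ hu hgen
  refine ⟨(-1) ^ ℓ * (-1), by simp, ?_⟩
  rw [← h1, Algebra.PowerBasis.norm_gen_eq_coeff_zero_minpoly, h1, h2,
    minpoly_root_X (K := K) hℓ hζ hu]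
  simp [hℓ.ne_zero.symm]

include hgen in
lemma discr_root_X (b : Module.Basis (Fin ℓ) K E) (hb : ∀ i, b i = u ^ (i : ℕ)) :
    ∃ c : F, c ≠ 0 ∧ Algebra.discr K b = algebraMap F[X] K (C c * X ^ (ℓ - 1)) := by
  have : NeZero ℓ := ⟨hℓ.ne_zero⟩
  have hfin := finite_root_X (K := K) hℓ hζ hu hgen
  obtain ⟨pb, h1, h2⟩ := exists_powerBasis_root_X (K := K) hℓ hζ hu hgen
  have hsep : Algebra.IsSeparable K E := by
    have h0 : IsSeparable K u := isSeparable_of_pow_mem (natCast_ne_zero_of_isPrimitiveRoot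
        (IsFractionRing.injective F[X] K) (isPrimitiveRoot_C hζ))
        ⟨algebraMap F[X] K X, by rw [hu, ← IsScalarTower.algebraMap_apply]⟩
    have h3 := (IntermediateField.isSeparable_adjoin_iff_isSeparable K E (S := {u})).2
      (by simpa using h0)
    rw [IntermediateField.adjoin_eq_top_of_algebra _ _ hgen] at h3
    exact AlgEquiv.Algebra.isSeparable IntermediateField.topEquiv
  have hbp : Algebra.discr K b = Algebra.discr K pb.basis := by
    rw [← Algebra.discr_reindex K b (finCongr h2.symm)]
    congr 1
    funext i
    simp [hb, h1]
  obtain ⟨c, hc0, hc⟩ := norm_root_X (K := K) hℓ hζ hu hgen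
  refine ⟨(-1) ^ (ℓ * (ℓ - 1) / 2) * (ℓ ^ ℓ * c ^ (ℓ - 1)), ?_, ?_⟩
  · have := hζ.neZero'.out
    simp [this, hc0]
  · rw [hbp, Algebra.discr_powerBasis_eq_norm, pb.finrank, h2, h1,
      minpoly_root_X (K := K) hℓ hζ hu]
    have hd : aeval u (derivative (X ^ ℓ - C (algebraMap F[X] K X))) =
        algebraMap K E (ℓ : K) * u ^ (ℓ - 1) := by
      simp [derivative_X_pow]
    rw [hd, map_mul, Algebra.norm_algebraMap, map_pow, hc, pb.finrank, h2]
    simp only [map_mul, map_pow, map_neg, map_one, map_natCast]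
    ring

end RootOfX

/-! ### The polynomial ring in the root of the variable -/

section PolynomialRing

variable {F K E : Type*} [Field F] [Field K] [Algebra F[X] K] [IsFractionRing F[X] K]
  [Field E] [Algebra K E] [Algebra F[X] E] [IsScalarTower F[X] K E] {ℓ : ℕ} {u : E}

lemma self_mem_adjoin (u : E) : u ∈ Algebra.adjoin F[X] {u} :=
  Algebra.self_mem_adjoin_singleton _ _

/-- The substitution `X ↦ u` as a ring homomorphism `F[X] → F[X][u]`; it is not a homomorphism of
`F[X]`-algebras. -/
noncomputable def substRoot (u : E) : F[X] →+* Algebra.adjoin F[X] {u} :=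
  eval₂RingHom ((algebraMap F[X] (Algebra.adjoin F[X] {u})).comp C) ⟨u, self_mem_adjoin u⟩

@[simp] lemma substRoot_C (c : F) :
    ((substRoot u (C c) : Algebra.adjoin F[X] {u}) : E) = algebraMap F[X] E (C c) := by
  simp [substRoot]

@[simp] lemma substRoot_X : ((substRoot u (X : F[X]) : Algebra.adjoin F[X] {u}) : E) = u := by
  simp [substRoot]

variable (hℓ : ℓ.Prime) (hu : u ^ ℓ = algebraMap F[X] E X)

include hu in
/-- The elements of the base ring `F[X]` are the polynomials in `u ^ ℓ`. -/
lemma substRoot_expand (g : F[X]) :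
    ((substRoot u (expand F ℓ g) : Algebra.adjoin F[X] {u}) : E) = algebraMap F[X] E g := by
  induction g using Polynomial.induction_on' with
  | add p q hp hq => simp [hp, hq]
  | monomial n a =>
    rw [expand_monomial, ← C_mul_X_pow_eq_monomial, ← C_mul_X_pow_eq_monomial]
    simp only [map_mul, map_pow, MulMemClass.coe_mul, SubmonoidClass.coe_pow, substRoot_C,
      substRoot_X, ← hu]
    ring

include hu in
lemma substRoot_surjective : Function.Surjective (substRoot (F := F) u) := by
  rintro ⟨x, hx⟩
  suffices h : ∃ g : F[X], ((substRoot u g : Algebra.adjoin F[X] {u}) : E) = x by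
    obtain ⟨g, hg⟩ := h
    exact ⟨g, Subtype.ext hg⟩
  induction hx using Algebra.adjoin_induction with
  | mem x hx => exact ⟨X, by rw [substRoot_X, Set.mem_singleton_iff.1 hx]⟩
  | algebraMap g => exact ⟨_, substRoot_expand hu g⟩
  | add x y _ _ hx hy =>
    obtain ⟨f, rfl⟩ := hx
    obtain ⟨g, rfl⟩ := hy
    exact ⟨f + g, by simp⟩
  | mul x y _ _ hx hy =>
    obtain ⟨f, rfl⟩ := hx
    obtain ⟨g, rfl⟩ := hy
    exact ⟨f * g, by simp⟩

include K hu in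
variable (K) in
/-- `u` is transcendental over `F`, as its power `X` is. -/
lemma substRoot_injective : Function.Injective (substRoot (F := F) u) := by
  let _ : Algebra F E := ((algebraMap F[X] E).comp C).toAlgebra
  have : IsScalarTower F F[X] E := IsScalarTower.of_algebraMap_eq fun _ => rfl
  have hinj : Function.Injective (algebraMap F[X] E) := by
    rw [IsScalarTower.algebraMap_eq F[X] K E]
    exact (algebraMap K E).injective.comp (IsFractionRing.injective F[X] K)
  have htr : Transcendental F u := fun h => by
    have h1 := h.pow ℓ
    rw [hu, isAlgebraic_algebraMap_iff hinj] at h1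
    exact transcendental_X F h1
  refine (injective_iff_map_eq_zero _).2 fun g hg => ?_
  have h2 : ((substRoot u g : Algebra.adjoin F[X] {u}) : E) = aeval u g := by
    have h3 : (Algebra.adjoin F[X] {u}).val.toRingHom.comp (substRoot u) =
        (aeval u : F[X] →ₐ[F] E).toRingHom := by
      refine ringHom_ext (fun a => ?_) ?_
      · simp [substRoot, RingHom.algebraMap_toAlgebra]
      · simp [substRoot]
    exact DFunLike.congr_fun h3 g
  rw [hg] at h2
  exact (transcendental_iff.1 htr) g h2.symm

variable (K) in
/-- The ring `F[X][u]` is a polynomial ring in `u`. -/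
noncomputable def substRootEquiv : F[X] ≃+* Algebra.adjoin F[X] {u} :=
  RingEquiv.ofBijective (substRoot u) ⟨substRoot_injective K hu, substRoot_surjective hu⟩

include hℓ hu in
lemma exists_sum_of_mem_adjoin {x : E} (hx : x ∈ Algebra.adjoin F[X] {u}) :
    ∃ g : Fin ℓ → F[X], x = ∑ i, g i • u ^ (i : ℕ) := by
  rw [Algebra.adjoin_singleton_eq_range_aeval] at hx
  obtain ⟨f, rfl⟩ := hx
  have hm : (X ^ ℓ - C X : F[X][X]).Monic := monic_X_pow_sub_C X hℓ.ne_zero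
  have hroot : aeval u (X ^ ℓ - C X : F[X][X]) = 0 := by simp [hu]
  refine ⟨fun i => (f %ₘ (X ^ ℓ - C X)).coeff i, ?_⟩
  have hdeg : (f %ₘ (X ^ ℓ - C X)).natDegree < ℓ := by
    have := natDegree_modByMonic_lt f hm (fun h => by
      have := congrArg natDegree h
      rw [natDegree_X_pow_sub_C, natDegree_one] at this
      exact hℓ.ne_zero this)
    rwa [natDegree_X_pow_sub_C] at this
  rw [AlgHom.toRingHom_eq_coe, RingHom.coe_coe, ← aeval_modByMonic_eq_self_of_root hroot,
    aeval_eq_sum_range' hdeg, Finset.sum_range]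

include K hℓ hu in
variable (K) in
lemma isFractionRing_adjoin_root {ζ : F} (hζ : IsPrimitiveRoot ζ ℓ)
    (hgen : Algebra.adjoin K {u} = ⊤) : IsFractionRing (Algebra.adjoin F[X] {u}) E := by
  refine IsFractionRing.of_field _ _ fun x => ?_
  obtain ⟨b, hb⟩ := exists_basis_root_X (K := K) hℓ hζ hu hgen
  obtain ⟨d, hd⟩ := IsLocalization.exist_integer_multiples_of_finite (nonZeroDivisors F[X])
    (fun i => b.repr x i)
  choose g hg using hd
  refine ⟨⟨∑ i, g i • u ^ (i : ℕ), ?_⟩, algebraMap F[X] _ d, ?_⟩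
  · exact Subalgebra.sum_mem _ fun i _ => Subalgebra.smul_mem _
      (Subalgebra.pow_mem _ (self_mem_adjoin u) _) _
  · have hd0 : algebraMap F[X] E d ≠ 0 := by
      rw [IsScalarTower.algebraMap_apply F[X] K E]
      exact (_root_.map_ne_zero _).2
        (IsFractionRing.to_map_ne_zero_of_mem_nonZeroDivisors d.2)
    rw [← IsScalarTower.algebraMap_apply, eq_div_iff hd0]
    change _ = ∑ i, g i • u ^ (i : ℕ)
    conv_lhs => rw [← b.sum_repr x, Finset.sum_mul]
    refine Finset.sum_congr rfl fun i _ => ?_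
    rw [← IsScalarTower.algebraMap_smul K (g i), hg, hb, mul_comm, ← Algebra.smul_def, smul_assoc]

lemma prod_one_sub_pow_mul {A : Type*} [CommRing A] [IsDomain A] [NeZero ℓ] {z : A}
    (hz : IsPrimitiveRoot z ℓ) (x : A) : ∏ m : ZMod ℓ, (1 - z ^ m.val * x) = 1 - x ^ ℓ := by
  have h := hz.pow_sub_pow_eq_prod_sub_mul 1 x (NeZero.pos ℓ)
  rw [one_pow] at h
  rw [h]
  refine Finset.prod_bij (fun m _ => z ^ m.val) (fun m _ => ?_) (fun m _ n _ hmn => ?_)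
    (fun y hy => ?_) (fun _ _ => rfl)
  · rw [mem_nthRootsFinset (NeZero.pos ℓ), ← pow_mul, mul_comm, pow_mul, hz.pow_eq_one, one_pow]
  · exact ZMod.val_injective ℓ (hz.pow_inj (ZMod.val_lt m) (ZMod.val_lt n) hmn)
  · rw [mem_nthRootsFinset (NeZero.pos ℓ)] at hy
    obtain ⟨i, hi, rfl⟩ := hz.eq_pow_of_pow_eq_one hy
    exact ⟨i, Finset.mem_univ _, by rw [ZMod.val_natCast, Nat.mod_eq_of_lt hi]⟩

lemma prime_one_sub_C_mul_X {a : F} (ha : a ≠ 0) : Prime (1 - C a * X : F[X]) := by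
  refine (irreducible_of_degree_eq_one ?_).prime
  have h : (1 - C a * X : F[X]) = C (-a) * X + C 1 := by simp; ring
  rw [h, degree_linear (neg_ne_zero.2 ha)]

lemma eq_of_associated_one_sub_C_mul_X {a b : F}
    (h : Associated (1 - C a * X : F[X]) (1 - C b * X)) : a = b := by
  obtain ⟨v, hv⟩ := h
  obtain ⟨c, hc, hcv⟩ := Polynomial.isUnit_iff.1 v.isUnit
  rw [← hcv] at hv
  have h0 : c = 1 := by simpa using congrArg (eval 0) hv
  have h1 := congrArg (eval 1) hv
  simpa [h0] using h1

end PolynomialRing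

/-! ### Integral bases and the discriminant ideal -/

section IntegralBasis

variable {A K L ι : Type*} [CommRing A] [IsDomain A] [Field K] [Algebra A K] [IsFractionRing A K]
  [Field L] [Algebra K L] [Algebra A L] [IsScalarTower A K L] [Fintype ι]
  (b : Module.Basis ι K L) (hint : ∀ i, IsIntegral A (b i))
  (hrepr : ∀ x, IsIntegral A x → ∀ i, b.repr x i ∈ Set.range (algebraMap A K))

include hint hrepr

lemma exists_basis_integralClosure :
    ∃ B : Module.Basis ι A (integralClosure A L), ∀ i, (B i : L) = b i := by
  let v : ι → integralClosure A L := fun i => ⟨b i, hint i⟩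
  have hli : LinearIndependent A v := by
    apply LinearIndependent.of_comp (integralClosure A L).val.toLinearMap
    exact b.linearIndependent.restrict_scalars' A
  have hspan : ⊤ ≤ Submodule.span A (Set.range v) := by
    rintro ⟨x, hx⟩ -
    choose a ha using hrepr x hx
    have h1 : (⟨x, hx⟩ : integralClosure A L) = ∑ i, a i • v i := by
      apply Subtype.ext
      rw [AddSubmonoidClass.coe_finsetSum]
      refine (b.sum_repr x).symm.trans ?_
      refine Finset.sum_congr rfl fun i _ => ?_
      rw [← ha, algebraMap_smul]
      rfl
    rw [h1]
    exact Submodule.sum_mem _ fun i _ => Submodule.smul_mem _ _ (Submodule.subset_span ⟨i, rfl⟩)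
  exact ⟨Module.Basis.mk hli hspan, fun i => by rw [Module.Basis.mk_apply]⟩

/-- Any other basis of integral elements is the image of the integral basis under a matrix over
`A`, which multiplies the discriminant by the square of its determinant. -/
lemma discriminantIdeal_eq_span [DecidableEq ι] {D : A}
    (hD : Algebra.discr K b = algebraMap A K D) :
    discriminantIdeal A K L = Ideal.span {D} := by
  apply le_antisymm
  · refine Ideal.span_le.2 ?_
    rintro d ⟨b', hb', hd⟩
    have hcard : Module.finrank K L = Fintype.card ι := Module.finrank_eq_card_basis b
    let f : Fin (Module.finrank K L) ≃ ι := (finCongr hcard).trans (Fintype.equivFin ι).symm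
    choose a ha using fun j => hrepr (b' (f.symm j)) (hb' _)
    let P : Matrix ι ι A := Matrix.of fun i j => a j i
    have h1 : b' ∘ f.symm = Matrix.vecMul b
        ((P.map (algebraMap A K)).map (algebraMap K L)) := by
      funext j
      rw [Function.comp_apply, ← b.sum_repr (b' (f.symm j))]
      refine Finset.sum_congr rfl fun i _ => ?_
      rw [← ha, Algebra.smul_def, mul_comm]
      rfl
    rw [← Algebra.discr_reindex K b' f, h1, Algebra.discr_of_matrix_vecMul, hD] at hd
    have h2 : (P.map (algebraMap A K)).det = algebraMap A K P.det :=
      ((algebraMap A K).map_det P).symm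
    rw [h2, ← map_pow, ← map_mul] at hd
    rw [IsFractionRing.injective A K hd]
    exact Ideal.mul_mem_left _ _ (Ideal.mem_span_singleton_self D)
  · rw [Ideal.span_singleton_le_iff_mem]
    have hcard : Module.finrank K L = Fintype.card ι := Module.finrank_eq_card_basis b
    let f : Fin (Module.finrank K L) ≃ ι := (finCongr hcard).trans (Fintype.equivFin ι).symm
    refine Ideal.subset_span ⟨b.reindex f.symm, fun i => ?_, ?_⟩
    · rw [Module.Basis.reindex_apply]
      exact hint _
    · rw [← hD, ← Algebra.discr_reindex K b f.symm, Module.Basis.coe_reindex]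

end IntegralBasis

/-! ### The basis indexed by affine exponent vectors -/

section Tower

variable {F K E R : Type*} [Field F] [Field K] [Algebra F[X] K] [IsFractionRing F[X] K]
  [Field E] [Algebra K E] [Algebra F[X] E] [IsScalarTower F[X] K E]
  [Field R] [Algebra K R] [Algebra F[X] R] [IsScalarTower F[X] K R]
  [Algebra E R] [IsScalarTower K E R] [IsScalarTower F[X] E R]
  {ℓ : ℕ} (hℓ : ℓ.Prime) {ζ : F} (hζ : IsPrimitiveRoot ζ ℓ) {u : E}
  (hu : u ^ ℓ = algebraMap F[X] E X)

/-- The exponent vectors `m ↦ c * m + d` modulo `ℓ`: they are the combinations of the exponent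
vector `m ↦ m` of `ε` and the constant vector `1` of `1 - t`. -/
def affineExponent (ℓ : ℕ) : ZMod ℓ × ZMod ℓ →+ (ZMod ℓ → ZMod ℓ) :=
  AddMonoidHom.mk' (fun h m => h.1 * m + h.2) fun g h => by
    funext m
    simp only [Prod.fst_add, Prod.snd_add, Pi.add_apply]
    ring

lemma affineExponent_apply (h : ZMod ℓ × ZMod ℓ) (m : ZMod ℓ) :
    affineExponent ℓ h m = h.1 * m + h.2 := rfl

lemma affineExponent_injective : Function.Injective (affineExponent ℓ) := by
  intro g h hgh
  have h0 := congrFun hgh 0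
  have h1 := congrFun hgh 1
  simp only [affineExponent_apply, mul_zero, zero_add, mul_one] at h0 h1
  rw [h0] at h1
  exact Prod.ext (add_right_cancel h1) h0

/-- Each factor `1 - ζ ^ m * u` occurs in all but `ℓ` of the `ℓ ^ 2` monomials. -/
lemma card_affineExponent_ne_zero [NeZero ℓ] (m : ZMod ℓ) :
    Finset.card {h : ZMod ℓ × ZMod ℓ | affineExponent ℓ h m ≠ 0} = ℓ * (ℓ - 1) := by
  have h1 : Finset.card {h : ZMod ℓ × ZMod ℓ | affineExponent ℓ h m = 0} = ℓ := by
    refine (Finset.card_bij' (t := Finset.univ) (fun h _ => h.1) (fun c _ => (c, -(c * m)))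
      ?_ ?_ ?_ ?_).trans (by rw [Finset.card_univ, ZMod.card])
    · simp
    · exact fun c _ => Finset.mem_filter.2 ⟨Finset.mem_univ _, by simp [affineExponent_apply]⟩
    · rintro ⟨c, d⟩ h
      exact Prod.ext rfl (neg_eq_of_add_eq_zero_right (Finset.mem_filter.1 h).2)
    · simp
  have h2 := Finset.card_filter_add_card_filter_not (s := (Finset.univ : Finset (ZMod ℓ × ZMod ℓ)))
    (fun h => affineExponent ℓ h m = 0)
  rw [h1, Finset.card_univ, Fintype.card_prod, ZMod.card] at h2
  simp only [ne_eq]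
  rw [Nat.mul_sub, mul_one]
  omega

variable [NeZero ℓ]

/-- The monomial in the factors `1 - ζ ^ m * u` of `1 - t` with exponent vector `h`. -/
noncomputable def affineRadicand (ζ : F) (u : R) (h : ZMod ℓ × ZMod ℓ) : R :=
  ∏ m : ZMod ℓ, (1 - algebraMap F[X] R (C ζ) ^ m.val * u) ^ (h.1 * m + h.2).val

variable (K) in
/-- The `ℓ`-th roots of the monomials in the primes `1 - ζ ^ m * u` of `F[X][u]`. -/
noncomputable def affineFamily (y : ZMod ℓ × ZMod ℓ → R)
    (hy : ∀ h, y h ^ ℓ = affineRadicand ζ (algebraMap E R u) h) :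
    RadicalFamily ℓ (Algebra.adjoin F[X] {u}) R (ZMod ℓ) (ZMod ℓ × ZMod ℓ) where
  π m := substRootEquiv K hu (1 - C (ζ ^ m.val) * X)
  prime m := (MulEquiv.prime_iff (substRootEquiv K hu)).2
    (prime_one_sub_C_mul_X (pow_ne_zero _ (hζ.ne_zero (NeZero.ne ℓ))))
  eq_of_associated m n h := by
    have h1 := h.map (substRootEquiv K hu).symm
    simp only [RingEquiv.symm_apply_apply] at h1
    exact ZMod.val_injective ℓ (hζ.pow_inj (ZMod.val_lt m) (ZMod.val_lt n)
      (eq_of_associated_one_sub_C_mul_X h1))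
  e := affineExponent ℓ
  e_injective := affineExponent_injective
  y := y
  y_pow h := by
    rw [hy, affineRadicand, map_prod]
    refine Finset.prod_congr rfl fun m _ => ?_
    rw [map_pow, affineExponent_apply]
    congr 1
    rw [IsScalarTower.algebraMap_apply (Algebra.adjoin F[X] {u}) E R]
    change _ = algebraMap E R (substRoot u (1 - C (ζ ^ m.val) * X) : Algebra.adjoin F[X] {u})
    rw [map_sub, map_mul, map_one]
    simp only [AddSubgroupClass.coe_sub, MulMemClass.coe_mul, OneMemClass.coe_one,
      SubmonoidClass.coe_pow, substRoot_C, substRoot_X, map_sub, map_mul, map_one, map_pow,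
      ← IsScalarTower.algebraMap_apply]

variable (K) in
lemma prod_affineFamily_π (y : ZMod ℓ × ZMod ℓ → R)
    (hy : ∀ h, y h ^ ℓ = affineRadicand ζ (algebraMap E R u) h) :
    algebraMap (Algebra.adjoin F[X] {u}) E (∏ m, (affineFamily K hζ hu y hy).π m) =
      algebraMap F[X] E (1 - X) := by
  have h1 : ∏ m, (affineFamily K hζ hu y hy).π m = substRoot u (1 - X ^ ℓ) := by
    rw [← prod_one_sub_pow_mul (isPrimitiveRoot_C hζ) X, map_prod]
    simp_rw [← C_pow]
    rfl
  rw [h1]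
  change ((substRoot u (1 - X ^ ℓ) : Algebra.adjoin F[X] {u}) : E) = _
  simp [hu]

include hℓ hζ hu in
/-- The products `u ^ i * y h` form a `K`-basis of `R`, the coordinates of integral elements are
polynomials, and the discriminant is the stated one: the relative discriminant contributes the
power of `1 - X` and the discriminant of `K(u)` the power of `X`. -/
lemma exists_integral_basis (hE : Algebra.adjoin K {u} = ⊤) {v w : R}
    (hR : Algebra.adjoin E {v, w} = ⊤) (hv : v ^ ℓ = affineRadicand ζ (algebraMap E R u)
      ((0, 1) : ZMod ℓ × ZMod ℓ))
    (hw : w ^ ℓ = affineRadicand ζ (algebraMap E R u) ((1, 0) : ZMod ℓ × ZMod ℓ))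
    {y : ZMod ℓ × ZMod ℓ → R}
    (hy : ∀ h, y h ^ ℓ = affineRadicand ζ (algebraMap E R u) h) :
    ∃ b : Module.Basis (Fin ℓ × (ZMod ℓ × ZMod ℓ)) K R,
      (∀ i h, b (i, h) = algebraMap E R u ^ (i : ℕ) * y h) ∧
      (∀ x, IsIntegral F[X] x → ∀ j, b.repr x j ∈ Set.range (algebraMap F[X] K)) ∧
      ∃ c : F, c ≠ 0 ∧
        Algebra.discr K b = algebraMap F[X] K (C c * (X * (1 - X)) ^ (ℓ ^ 2 * (ℓ - 1))) := by
  have hfinE : FiniteDimensional K E := finite_root_X (K := K) hℓ hζ hu hE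
  have := isFractionRing_adjoin_root K hℓ hu hζ hE
  have : UniqueFactorizationMonoid (Algebra.adjoin F[X] {u}) :=
    (substRootEquiv K hu).toMulEquiv.uniqueFactorizationMonoid inferInstance
  have hinj : Function.Injective (algebraMap F[X] E) := by
    rw [IsScalarTower.algebraMap_eq F[X] K E]
    exact (algebraMap K E).injective.comp (IsFractionRing.injective F[X] K)
  have hz : IsPrimitiveRoot (algebraMap F[X] E (C ζ)) ℓ :=
    (isPrimitiveRoot_C hζ).map_of_injective hinj
  have hℓF : (ℓ : F) ≠ 0 := hζ.neZero'.out
  have hℓE : (ℓ : E) ≠ 0 := hz.neZero'.out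
  let G := affineFamily K hζ hu y hy
  have hGpow : ∀ h x, x ^ ℓ = affineRadicand ζ (algebraMap E R u) h →
      x ^ ℓ = algebraMap (Algebra.adjoin F[X] {u}) R (G.rad h) := fun h x hx => by
    rw [hx, ← hy h]
    exact G.y_pow h
  have hvw : ∀ s ∈ ({v, w} : Set R), ∃ h, s ^ ℓ =
      algebraMap (Algebra.adjoin F[X] {u}) R (G.rad h) := by
    rintro s (rfl | rfl)
    · exact ⟨_, hGpow _ _ hv⟩
    · exact ⟨_, hGpow _ _ hw⟩
  have hvwE : ∀ s ∈ ({v, w} : Set R), s ^ ℓ ∈ Set.range (algebraMap E R) := fun s hs => by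
    obtain ⟨h, hh⟩ := hvw s hs
    exact ⟨algebraMap (Algebra.adjoin F[X] {u}) E (G.rad h),
      by rw [hh, ← IsScalarTower.algebraMap_apply]⟩
  have hfinR : FiniteDimensional E R := by
    have h1 : (Algebra.adjoin E {v, w}).toSubmodule.FG :=
      fg_adjoin_of_finite (Set.toFinite _) fun s hs => by
        obtain ⟨c, hc⟩ := hvwE s hs
        exact isIntegral_of_pow_eq_algebraMap hℓ.ne_zero hc.symm
    rw [hR, Algebra.top_toSubmodule] at h1
    exact ⟨h1⟩
  have hsepR : Algebra.IsSeparable E R := by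
    have h1 := (IntermediateField.isSeparable_adjoin_iff_isSeparable E R (S := {v, w})).2
      fun s hs => isSeparable_of_pow_mem hℓE (hvwE s hs)
    rw [IntermediateField.adjoin_eq_top_of_algebra _ _ hR] at h1
    exact AlgEquiv.Algebra.isSeparable IntermediateField.topEquiv
  have hspan := G.span_range_y hz hR hvw
  have hli := G.linearIndependent_y hℓ hz (G.trace_one_ne_zero hℓ hz hspan)
  let bR : Module.Basis (ZMod ℓ × ZMod ℓ) E R := Module.Basis.mk hli hspan.ge
  have hbR : ∀ h, bR h = y h := fun h => by rw [Module.Basis.mk_apply]; rfl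
  obtain ⟨bE, hbE⟩ := exists_basis_root_X (K := K) hℓ hζ hu hE
  have hb : ∀ i h, bE.smulTower bR (i, h) = algebraMap E R u ^ (i : ℕ) * y h := fun i h => by
    rw [Module.Basis.smulTower_apply, hbE, hbR, Algebra.smul_def, map_pow]
  refine ⟨bE.smulTower bR, hb, ?_, ?_⟩
  · rintro x hx ⟨i, h⟩
    have hunit : IsUnit ((Fintype.card (ZMod ℓ × ZMod ℓ) : ℕ) : Algebra.adjoin F[X] {u}) := by
      rw [Fintype.card_prod, ZMod.card, ← map_natCast (algebraMap F[X] (Algebra.adjoin F[X] {u})),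
        ← map_natCast C]
      refine IsUnit.map _ (IsUnit.map _ ?_)
      push_cast
      exact (mul_ne_zero hℓF hℓF).isUnit
    -- The coefficient of `x` along `y h` lies in `F[X][u]`; expand it in powers of `u`.
    obtain ⟨⟨e, he⟩, hf⟩ := G.repr_mem_range hℓ hz hunit bR hbR hx.tower_top h
    obtain ⟨g, hg⟩ := exists_sum_of_mem_adjoin hℓ hu he
    refine ⟨g i, ?_⟩
    rw [Module.Basis.smulTower_repr_mk, ← hf]
    change _ = bE.repr e i
    have h1 : e = ∑ j, algebraMap F[X] K (g j) • bE j := by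
      rw [hg]
      exact Finset.sum_congr rfl fun j _ => by rw [hbE, algebraMap_smul]
    rw [h1, bE.repr_sum_self]
  · obtain ⟨c, hc0, hc⟩ := discr_root_X (K := K) hℓ hζ hu hE bE hbE
    obtain ⟨s, hs⟩ := discr_smul_of_trace_eq_zero bE y
      (fun h h' hh => G.trace_mul_eq_zero hz hℓ hh)
    obtain ⟨i, hi⟩ := G.exists_prod_trace hz card_affineExponent_ne_zero
    have hfr : Module.finrank E R = ℓ ^ 2 := by
      rw [Module.finrank_eq_card_basis bR, Fintype.card_prod, ZMod.card, sq]
    have hfun : (bE.smulTower bR : Fin ℓ × (ZMod ℓ × ZMod ℓ) → R) =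
        fun x => bE x.1 • y x.2 := by
      funext x
      rw [Module.Basis.smulTower_apply, hbR]
    rw [hfun, hs, hc]
    change ∏ h, Algebra.trace E R (y h * y (-h)) = _ at hi
    have hprod : ∏ h, Algebra.trace E R (y h * y (-h)) = algebraMap K E (algebraMap F[X] K
        (C ((ℓ ^ 2) ^ ℓ ^ 2 * ζ ^ i) * (1 - X) ^ (ℓ * (ℓ - 1)))) := by
      rw [hi, prod_affineFamily_π K hζ hu y hy, hfr, Fintype.card_prod, ZMod.card, ← sq,
        ← IsScalarTower.algebraMap_apply]
      simp only [map_mul, map_pow, map_natCast, Nat.cast_pow]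
    have hfK : Module.finrank K E = ℓ := by
      rw [Module.finrank_eq_card_basis bE, Fintype.card_fin]
    refine ⟨((s : ℤ) : F) * (((ℓ ^ 2) ^ ℓ ^ 2 * ζ ^ i) ^ ℓ * c ^ ℓ ^ 2), ?_, ?_⟩
    · have hs0 : ((s : ℤ) : F) ≠ 0 := (s.isUnit.map (Int.castRingHom F)).ne_zero
      have hζ0 : ζ ≠ 0 := hζ.ne_zero (NeZero.ne ℓ)
      simp [hs0, hζ0, hℓF, hc0]
    · rw [hprod, Algebra.norm_algebraMap, hfK, Fintype.card_prod, ZMod.card, ← sq,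
        ← map_intCast (algebraMap F[X] K), ← map_pow, ← map_pow, ← map_mul, ← map_mul]
      congr 1
      have h1 : ℓ ^ 2 * (ℓ - 1) = ℓ * (ℓ - 1) * ℓ := by ring
      simp only [map_mul, map_pow, map_natCast, map_intCast, mul_pow, ← pow_mul]
      rw [h1]
      ring

end Tower

/-! ### The radicands of the Heisenberg extension -/

section Radicands

variable {F R : Type*} [Field F] [Field R] [Algebra F[X] R] {ℓ : ℕ}

lemma prod_range_eq_prod_zmod [NeZero ℓ] {R : Type*} [CommMonoid R] (f : ℕ → R) :
    ∏ n ∈ Finset.range ℓ, f n = ∏ m : ZMod ℓ, f m.val := by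
  refine Finset.prod_bij' (fun n _ => (n : ZMod ℓ)) (fun m _ => m.val) (by simp)
    (fun m _ => Finset.mem_range.2 (ZMod.val_lt m)) (fun n hn => ?_) (by simp) (fun n hn => ?_)
  all_goals rw [ZMod.val_natCast, Nat.mod_eq_of_lt (Finset.mem_range.1 hn)]

variable [NeZero ℓ] {ζ : F} {u : R}

/-- With `m = n + j` the exponent `k * n` becomes `k * m - k * j`, an affine function of `m`. -/
lemma radicand_eq_affineRadicand (hz : IsPrimitiveRoot (algebraMap F[X] R (C ζ)) ℓ) (k j : ℕ) :
    radicand ℓ (algebraMap F[X] R (C ζ)) u k j =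
      affineRadicand ζ u ((k, -(k * j)) : ZMod ℓ × ZMod ℓ) := by
  have h1 : Finset.range ℓ = insert 0 (Finset.Icc 1 (ℓ - 1)) := by
    ext n
    have := NeZero.pos ℓ
    simp only [Finset.mem_range, Finset.mem_insert, Finset.mem_Icc]
    omega
  have h2 : radicand ℓ (algebraMap F[X] R (C ζ)) u k j = ∏ n ∈ Finset.range ℓ,
      (1 - algebraMap F[X] R (C ζ) ^ (n + j) * u) ^ ((k * n) % ℓ) := by
    rw [h1, Finset.prod_insert (by simp), mul_zero, Nat.zero_mod, pow_zero, one_mul, radicand]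
  rw [h2, prod_range_eq_prod_zmod, affineRadicand]
  rw [← Equiv.prod_comp (Equiv.addRight (j : ZMod ℓ))
    (fun m => (1 - algebraMap F[X] R (C ζ) ^ m.val * u) ^ ((k : ZMod ℓ) * m + -(k * j)).val)]
  refine Finset.prod_congr rfl fun m _ => ?_
  have h3 : algebraMap F[X] R (C ζ) ^ (m.val + j) =
      algebraMap F[X] R (C ζ) ^ (m + (j : ZMod ℓ)).val := by
    rw [ZMod.val_add, ZMod.val_natCast, Nat.add_mod_mod, pow_eq_pow_mod (m.val + j) hz.pow_eq_one]
  have h4 : (k : ZMod ℓ) * (m + j) + -(k * j) = ((k * m.val : ℕ) : ZMod ℓ) := by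
    rw [Nat.cast_mul, ZMod.natCast_zmod_val]; ring
  rw [Equiv.coe_addRight]
  simp only [h3, h4, ZMod.val_natCast]

lemma epsilon_eq_affineRadicand (hz : IsPrimitiveRoot (algebraMap F[X] R (C ζ)) ℓ) :
    epsilon ℓ (algebraMap F[X] R (C ζ)) u =
      affineRadicand ζ u ((1, 0) : ZMod ℓ × ZMod ℓ) := by
  have h := radicand_eq_affineRadicand (u := u) hz 1 0
  simp only [Nat.cast_one, Nat.cast_zero, mul_zero, neg_zero] at h
  rw [← h, radicand, epsilon]
  refine Finset.prod_congr rfl fun n hn => ?_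
  rw [Finset.mem_Icc] at hn
  rw [add_zero, one_mul, Nat.mod_eq_of_lt (by omega)]

lemma affineRadicand_zero_natCast (hz : IsPrimitiveRoot (algebraMap F[X] R (C ζ)) ℓ) {j : ℕ}
    (hj : j < ℓ) : affineRadicand ζ u ((0, j) : ZMod ℓ × ZMod ℓ) = (1 - u ^ ℓ) ^ j := by
  rw [← prod_one_sub_pow_mul hz, affineRadicand, ← Finset.prod_pow]
  refine Finset.prod_congr rfl fun m _ => ?_
  rw [zero_mul, zero_add, ZMod.val_natCast, Nat.mod_eq_of_lt hj]

/-- The exponents `c * m + d` and their residues differ by multiples of `ℓ`. -/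
lemma affineRadicand_mul_pow (h : ZMod ℓ × ZMod ℓ) :
    affineRadicand ζ u h * (∏ m : ZMod ℓ, (1 - algebraMap F[X] R (C ζ) ^ m.val * u) ^
      ((h.1.val * m.val + h.2.val) / ℓ)) ^ ℓ =
    affineRadicand ζ u ((1, 0) : ZMod ℓ × ZMod ℓ) ^ h.1.val *
      (∏ m : ZMod ℓ, (1 - algebraMap F[X] R (C ζ) ^ m.val * u)) ^ h.2.val := by
  simp only [affineRadicand, ← Finset.prod_pow, ← Finset.prod_mul_distrib]
  refine Finset.prod_congr rfl fun m _ => ?_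
  rw [← pow_mul, ← pow_mul, ← pow_add, ← pow_add]
  congr 1
  rw [one_mul, add_zero, ZMod.val_add, ZMod.val_mul, Nat.mod_add_mod, mul_comm _ ℓ,
    Nat.mod_add_div, mul_comm h.1.val]

lemma isIntegral_affineRadicand (hu : IsIntegral F[X] u) (h : ZMod ℓ × ZMod ℓ) :
    IsIntegral F[X] (affineRadicand ζ u h) :=
  IsIntegral.prod _ fun _ _ =>
    (isIntegral_one.sub ((isIntegral_algebraMap.pow _).mul hu)).pow _

/-- Every monomial is a product of powers of `ε` and of `1 - t`, up to the `ℓ`-th power of an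
element of the field. -/
lemma mem_of_pow_eq_affineRadicand {K : Type*} [Field K] [Algebra K R] [Algebra F[X] K]
    [IsScalarTower F[X] K R] (hz : IsPrimitiveRoot (algebraMap F[X] R (C ζ)) ℓ)
    (hu1 : 1 - u ^ ℓ ≠ 0) {L : IntermediateField K R} (huL : u ∈ L) {v w : R} (hvL : v ∈ L)
    (hwL : w ∈ L) (hv : v ^ ℓ = 1 - u ^ ℓ)
    (hw : w ^ ℓ = affineRadicand ζ u ((1, 0) : ZMod ℓ × ZMod ℓ)) {x : R} {h : ZMod ℓ × ZMod ℓ}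
    (hx : x ^ ℓ = affineRadicand ζ u h) : x ∈ L := by
  have hzL : algebraMap F[X] R (C ζ) ∈ L := by
    rw [IsScalarTower.algebraMap_apply F[X] K R]
    exact L.algebraMap_mem _
  -- `D` absorbs the carries in the reduction of the exponents modulo `ℓ`.
  set D := ∏ m : ZMod ℓ, (1 - algebraMap F[X] R (C ζ) ^ m.val * u) ^
      ((h.1.val * m.val + h.2.val) / ℓ) with hD
  have hDL : D ∈ L := prod_mem fun m _ =>
    pow_mem (sub_mem (one_mem _) (mul_mem (pow_mem hzL _) huL)) _
  have hD0 : D ≠ 0 := by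
    rw [← prod_one_sub_pow_mul hz, Finset.prod_ne_zero_iff] at hu1
    exact Finset.prod_ne_zero_iff.2 fun m hm => pow_ne_zero _ (hu1 m hm)
  have h1 := affineRadicand_mul_pow (ζ := ζ) (u := u) h
  rw [prod_one_sub_pow_mul hz, ← hw, ← hv, ← hx, ← hD, ← mul_pow, pow_right_comm,
    pow_right_comm v, ← mul_pow] at h1
  obtain ⟨i, hi⟩ := exists_root_mul_of_pow_eq hz h1
  rw [← eq_div_iff hD0] at hi
  rw [hi]
  exact div_mem (mul_mem (pow_mem hzL _) (mul_mem (pow_mem hwL _) (pow_mem hvL _))) hDL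

variable (ℓ) in
/-- The index `(k, j)` corresponds to the exponent vector `m ↦ k * m - k * j` if `k ≠ 0`, and to
the constant vector `j` if `k = 0`. -/
def exponentIndex (x : Fin ℓ × Fin ℓ) : ZMod ℓ × ZMod ℓ :=
  ((x.1 : ℕ), if (x.1 : ℕ) = 0 then ((x.2 : ℕ) : ZMod ℓ) else -((x.1 : ℕ) * (x.2 : ℕ)))

lemma natCast_zmod_injOn {m n : ℕ} (hm : m < ℓ) (hn : n < ℓ) (h : (m : ZMod ℓ) = n) : m = n := by
  have := congrArg ZMod.val h
  rwa [ZMod.val_natCast, ZMod.val_natCast, Nat.mod_eq_of_lt hm, Nat.mod_eq_of_lt hn] at this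

lemma exponentIndex_bijective (hℓ : ℓ.Prime) : Function.Bijective (exponentIndex ℓ) := by
  have : Fact ℓ.Prime := ⟨hℓ⟩
  rw [Fintype.bijective_iff_injective_and_card]
  refine ⟨?_, by simp [ZMod.card]⟩
  rintro ⟨k, j⟩ ⟨k', j'⟩ h
  simp only [exponentIndex, Prod.mk.injEq] at h
  obtain ⟨h1, h2⟩ := h
  obtain rfl : k = k' := Fin.ext (natCast_zmod_injOn k.2 k'.2 h1)
  suffices h3 : ((j : ℕ) : ZMod ℓ) = (j' : ℕ) by
    rw [Fin.ext (natCast_zmod_injOn j.2 j'.2 h3)]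
  split_ifs at h2 with hk
  · exact h2
  · refine mul_left_cancel₀ (fun h0 => hk ?_) (neg_injective h2)
    exact natCast_zmod_injOn k.2 hℓ.pos (by simpa using h0)

end Radicands

/-! ### Integral basis and discriminant of the Heisenberg extension -/

section Tower

variable {F K R : Type*} [Field F] [Field K] [Algebra F[X] K] [IsFractionRing F[X] K]
  [Field R] [Algebra K R] [Algebra F[X] R] [IsScalarTower F[X] K R] {ℓ : ℕ} [NeZero ℓ]

lemma exists_integral_basis_of_adjoin_eq_top (hℓ : ℓ.Prime) {ζ : F} (hζ : IsPrimitiveRoot ζ ℓ)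
    {u v w : R} (hu : u ^ ℓ = algebraMap F[X] R X)
    (hgen : IntermediateField.adjoin K {u, v, w} = ⊤)
    (hv : v ^ ℓ = affineRadicand ζ u ((0, 1) : ZMod ℓ × ZMod ℓ))
    (hw : w ^ ℓ = affineRadicand ζ u ((1, 0) : ZMod ℓ × ZMod ℓ))
    {y : ZMod ℓ × ZMod ℓ → R}
    (hy : ∀ h, y h ^ ℓ = affineRadicand ζ u h) :
    ∃ b : Module.Basis (Fin ℓ × (ZMod ℓ × ZMod ℓ)) K R,
      (∀ i h, b (i, h) = u ^ (i : ℕ) * y h) ∧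
      (∀ x, IsIntegral F[X] x → ∀ j, b.repr x j ∈ Set.range (algebraMap F[X] K)) ∧
      ∃ c : F, c ≠ 0 ∧
        Algebra.discr K b = algebraMap F[X] K (C c * (X * (1 - X)) ^ (ℓ ^ 2 * (ℓ - 1))) := by
  let E := IntermediateField.adjoin K {u}
  let uE : E := IntermediateField.AdjoinSimple.gen K u
  have huE : uE ^ ℓ = algebraMap F[X] E X := Subtype.ext hu
  have huint : IsIntegral K u := isIntegral_of_pow_eq_algebraMap hℓ.ne_zero
    (by rw [hu, IsScalarTower.algebraMap_apply F[X] K R])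
  have hE : Algebra.adjoin K {uE} = ⊤ := by
    have h1 := (IntermediateField.adjoin.powerBasis huint).adjoin_gen_eq_top
    rwa [IntermediateField.adjoin.powerBasis_gen huint] at h1
  have hrad : ∀ h : ZMod ℓ × ZMod ℓ, affineRadicand ζ u h ∈ E := fun h =>
    prod_mem fun m _ => pow_mem (sub_mem (one_mem _) (mul_mem (pow_mem (by
      rw [IsScalarTower.algebraMap_apply F[X] K R]
      exact E.algebraMap_mem _) _) uE.2)) _
  have hR : Algebra.adjoin E {v, w} = ⊤ := by
    have h1 : IntermediateField.adjoin E {v, w} = ⊤ := by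
      apply IntermediateField.restrictScalars_injective K
      rw [IntermediateField.adjoin_adjoin_left, Set.singleton_union, hgen,
        IntermediateField.restrictScalars_top]
    rw [← IntermediateField.adjoin_toSubalgebra_of_isAlgebraic, h1,
      IntermediateField.top_toSubalgebra]
    rintro x (rfl | rfl)
    · exact (isIntegral_of_pow_eq_algebraMap hℓ.ne_zero
        (c := (⟨_, hrad (0, 1)⟩ : E)) hv).isAlgebraic
    · exact (isIntegral_of_pow_eq_algebraMap hℓ.ne_zero
        (c := (⟨_, hrad (1, 0)⟩ : E)) hw).isAlgebraic
  have : IsScalarTower F[X] E R := IsScalarTower.of_algebraMap_eq fun _ => rfl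
  exact exists_integral_basis (E := E) (u := uE) hℓ hζ huE hE hR hv hw hy

end Tower

end HeisenbergExtension

theorem mainTheorem3 (p ℓ : ℕ) [Fact p.Prime] (hℓ : ℓ.Prime) (hodd : Odd ℓ) (hdvd : ℓ ∣ p - 1)
    (ζ : ZMod p) (hζ : IsPrimitiveRoot ζ ℓ)
    (Ω : Type*) [Field Ω] [Algebra (RatFunc (ZMod p)) Ω] [Algebra (ZMod p)[X] Ω]
    [IsScalarTower (ZMod p)[X] (RatFunc (ZMod p)) Ω]
    (u v w : Ω)
    (hu : u ^ ℓ = algebraMap (ZMod p)[X] Ω X)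
    (hv : v ^ ℓ = algebraMap (ZMod p)[X] Ω (1 - X))
    (hw : w ^ ℓ = HeisenbergExtension.epsilon ℓ (algebraMap (ZMod p)[X] Ω (C ζ)) u)
    (a : ℕ → ℕ → Ω)
    (ha : ∀ k j : ℕ, 0 < k → k < ℓ → j < ℓ →
      a k j ^ ℓ = HeisenbergExtension.radicand ℓ (algebraMap (ZMod p)[X] Ω (C ζ)) u k j) :
    ∃ B : Module.Basis (Fin ℓ × Fin ℓ × Fin ℓ) (ZMod p)[X]
        (integralClosure (ZMod p)[X]
          (HeisenbergExtension.adjoinRoots (RatFunc (ZMod p)) u v w)),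
      (∀ k i j : Fin ℓ,
        (((B (k, i, j) : integralClosure (ZMod p)[X]
            (HeisenbergExtension.adjoinRoots (RatFunc (ZMod p)) u v w)) :
            HeisenbergExtension.adjoinRoots (RatFunc (ZMod p)) u v w) : Ω) =
          HeisenbergExtension.alpha u v a k i j) ∧
      (∃ c : ZMod p, c ≠ 0 ∧
        Algebra.discr (RatFunc (ZMod p))
            (fun x => (B x : HeisenbergExtension.adjoinRoots (RatFunc (ZMod p)) u v w)) =
          algebraMap (ZMod p)[X] (RatFunc (ZMod p))
            (C c * (X * (1 - X)) ^ (ℓ ^ 2 * (ℓ - 1)))) ∧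
      HeisenbergExtension.discriminantIdeal (ZMod p)[X] (RatFunc (ZMod p))
          (HeisenbergExtension.adjoinRoots (RatFunc (ZMod p)) u v w) =
        Ideal.span {(X * (1 - X)) ^ (ℓ ^ 2 * (ℓ - 1))} := by
  open HeisenbergExtension in
  have : NeZero ℓ := ⟨hℓ.ne_zero⟩
  let K := RatFunc (ZMod p)
  let L := adjoinRoots K u v w
  have htow : IsScalarTower (ZMod p)[X] L Ω := IsScalarTower.of_algebraMap_eq fun _ => rfl
  have huL : u ∈ L := IntermediateField.subset_adjoin _ _ (by simp)
  have hvL : v ∈ L := IntermediateField.subset_adjoin _ _ (by simp)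
  have hwL : w ∈ L := IntermediateField.subset_adjoin _ _ (by simp)
  have hinj : Function.Injective (algebraMap (ZMod p)[X] Ω) := by
    rw [IsScalarTower.algebraMap_eq (ZMod p)[X] K Ω]
    exact (algebraMap K Ω).injective.comp (IsFractionRing.injective (ZMod p)[X] K)
  have hz : IsPrimitiveRoot (algebraMap (ZMod p)[X] Ω (C ζ)) ℓ :=
    (isPrimitiveRoot_C hζ).map_of_injective hinj
  have hu1 : algebraMap (ZMod p)[X] Ω (1 - X) = 1 - u ^ ℓ := by rw [hu, map_sub, map_one]
  have hu0 : 1 - u ^ ℓ ≠ 0 := by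
    rw [← hu1, map_ne_zero_iff _ hinj]
    intro h
    simpa using congrArg (eval 0) h
  rw [hu1] at hv
  rw [epsilon_eq_affineRadicand hz] at hw
  let σ : Fin ℓ × Fin ℓ ≃ ZMod ℓ × ZMod ℓ := Equiv.ofBijective _ (exponentIndex_bijective hℓ)
  -- `y' (k, j)` is `alpha u v a k 0 j`: an `ℓ`-th root of the monomial with index `(k, j)`.
  let y' : Fin ℓ × Fin ℓ → Ω := fun x => if (x.1 : ℕ) = 0 then v ^ (x.2 : ℕ) else a x.1 x.2
  have hy' : ∀ x, y' x ^ ℓ = affineRadicand ζ u (exponentIndex ℓ x) := by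
    rintro ⟨k, j⟩
    simp only [y', exponentIndex]
    split_ifs with hk
    · rw [hk, Nat.cast_zero, affineRadicand_zero_natCast hz j.2, ← hv, pow_right_comm]
    · rw [ha k j (Nat.pos_of_ne_zero hk) k.2 j.2, radicand_eq_affineRadicand hz]
  have hyL : ∀ x, y' x ∈ L := fun x =>
    mem_of_pow_eq_affineRadicand hz hu0 huL hvL hwL hv hw (hy' x)
  have hcoe : ∀ h : ZMod ℓ × ZMod ℓ,
      ((affineRadicand ζ (⟨u, huL⟩ : L) h : L) : Ω) = affineRadicand ζ u h := fun h => by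
    change algebraMap L Ω _ = _
    rw [affineRadicand, map_prod]
    refine Finset.prod_congr rfl fun m _ => ?_
    rw [map_pow, map_sub, map_mul, map_one, map_pow, ← IsScalarTower.algebraMap_apply]
    rfl
  have hgen : IntermediateField.adjoin K {(⟨u, huL⟩ : L), ⟨v, hvL⟩, ⟨w, hwL⟩} = ⊤ := by
    apply IntermediateField.lift_injective L
    rw [IntermediateField.lift_adjoin, IntermediateField.lift_top, Set.image_insert_eq,
      Set.image_insert_eq, Set.image_singleton]
    rfl
  obtain ⟨b, hb, hrepr, c, hc0, hc⟩ := exists_integral_basis_of_adjoin_eq_top (K := K) (R := L)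
    (v := ⟨v, hvL⟩) (w := ⟨w, hwL⟩) (u := ⟨u, huL⟩) (y := fun h => ⟨y' (σ.symm h), hyL _⟩)
    hℓ hζ (Subtype.ext hu) hgen
    (Subtype.ext (by
      have h1 := affineRadicand_zero_natCast (u := u) hz hℓ.one_lt
      rw [Nat.cast_one, pow_one, ← hv] at h1
      rw [hcoe, h1]; rfl))
    (Subtype.ext (by rw [hcoe, ← hw]; rfl))
    (fun h => Subtype.ext (by
      rw [hcoe]
      refine (hy' _).trans ?_
      congr 1
      exact σ.apply_symm_apply h))
  let τ : Fin ℓ × Fin ℓ × Fin ℓ ≃ Fin ℓ × (ZMod ℓ × ZMod ℓ) :=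
    { toFun := fun x => (x.2.1, σ (x.1, x.2.2))
      invFun := fun x => ((σ.symm x.2).1, x.1, (σ.symm x.2).2)
      left_inv := fun x => by simp
      right_inv := fun x => by simp }
  let b' := b.reindex τ.symm
  have hb' : ∀ k i j, ((b' (k, i, j) : L) : Ω) = alpha u v a k i j := fun k i j => by
    have h1 : b' (k, i, j) = b (i, σ (k, j)) := by simp [b', τ]
    rw [h1, hb]
    change u ^ (i : ℕ) * y' (σ.symm (σ (k, j))) = _
    rw [σ.symm_apply_apply]
    simp only [y', alpha]
    split_ifs <;> rfl
  have hint : ∀ x, IsIntegral (ZMod p)[X] (b' x) := fun ⟨k, i, j⟩ => by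
    rw [← isIntegral_algebraMap_iff (algebraMap L Ω).injective]
    have h1 : b' (k, i, j) = b (i, σ (k, j)) := by simp [b', τ]
    rw [h1, hb]
    change IsIntegral (ZMod p)[X] (u ^ (i : ℕ) * y' (σ.symm (σ (k, j))))
    have huint := isIntegral_of_pow_eq_algebraMap hℓ.ne_zero hu
    refine (huint.pow _).mul (IsIntegral.of_pow hℓ.pos ?_)
    rw [hy']
    exact isIntegral_affineRadicand huint _
  have hrepr' : ∀ x, IsIntegral (ZMod p)[X] x → ∀ i,
      b'.repr x i ∈ Set.range (algebraMap (ZMod p)[X] K) := fun x hx i => by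
    rw [Module.Basis.repr_reindex_apply]
    exact hrepr x hx _
  have hdiscr : Algebra.discr K b' =
      algebraMap (ZMod p)[X] K (C c * (X * (1 - X)) ^ (ℓ ^ 2 * (ℓ - 1))) := by
    rw [← hc, ← Algebra.discr_reindex K b τ.symm, Module.Basis.coe_reindex]
  obtain ⟨B, hB⟩ := exists_basis_integralClosure b' hint hrepr'
  refine ⟨B, fun k i j => by rw [hB, hb'], ⟨c, hc0, ?_⟩, ?_⟩
  · rw [← hdiscr]
    congr 1
    exact funext hB
  · rw [discriminantIdeal_eq_span b' hint hrepr' hdiscr]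
    exact Ideal.span_singleton_mul_left_unit (isUnit_C.2 hc0.isUnit) _
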